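/- Let $D$ be an effective $\omega$-continuous domain: a partial order in which every non-empty directed set has a supremum, together with an enumeration $(b_n)_{n\in\mathbb N}$ (repetitions allowed) of a basis, such that $\{(i,j) : b_j\ll b_i\}$ is computably enumerable. Here $x\ll y$ means that every non-empty directed set $S$ with $y\sqsubseteq\bigsqcup S$ has an element $s\sqsupseteq x$, and $\{b_n : n\in\mathbb N\}$ is a basis if for every $x\in D$ the set $\{b_n : b_n\ll x\}$ is non-empty, directed and has supremum $x$. Give $D$ the Scott topology with the enumerated topological basis $O_n=\{x\in D : b_n\ll x\}$. A sequence $(X_n)_{n\in\mathbb N}$ of subsets of $D$ is uniformly $\Sigma^0_1$ if there is a computably enumerable set $I\subseteq\mathbb N^2$ with $X_n=\bigcup_{(n,i)\in I}O_i$ for all $n$; it is uniformly $\Pi^0_1$ if $(D\setminus X_n)_n$ is uniformly $\Sigma^0_1$. Define the following effective classes of subsets of $D$: - $G_\delta(D)$: the sets $\bigcap_n U_n$ with $(U_n)$ uniformly $\Sigma^0_1$; $F_\sigma(D)$: the sets $\bigcup_n F_n$ with $(F_n)$ uniformly $\Pi^0_1$. - $\Sigma^0_2(D)$: the sets $\bigcup_n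 (U_n\setminus V_n)$ with $(U_n)$ and $(V_n)$ uniformly $\Sigma^0_1$; $\Delta^0_2(D)$: the sets $X$ such that $X$ and $D\setminus X$ are in $\Sigma^0_2(D)$. - $D_\alpha(D)$, for an ordinal $1\le\alpha<\omega_1$: the sets of the form $$\bigcup_{p\in P}\Bigl(A_p\setminus\bigcup_{\varphi(q)<\varphi(p)}A_q\Bigr),$$ where $\preceq$ is a computable well-order of type $\alpha$ on $\mathbb N$ or on a finite initial segment of $\mathbb N$, $\varphi$ is the isomorphism from its domain $\mathrm{dom}(\preceq)$ onto $\alpha$, the set $P$ of those $p\in\mathrm{dom}(\preceq)$ for which $\varphi(p)$ and $\alpha$ have different parity is computable, $q$ ranges over $\mathrm{dom}(\preceq)$, and $(A_n)_{n\in\mathbb N}$ is uniformly $\Sigma^0_1$. (So $D_\alpha(D)$ is non-empty only if $\alpha$ is a computable ordinal.) Then $$G_\delta(D)\cap F_\sigma(D)\ \subseteq\ \bigcup_{1\le\alpha<\omega_1}D_\alpha(D)\ \subseteq\ \Delta^0_2(D).$$ -/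

import Mathlib

open Set

/-! ### Directed complete partial orders and continuous domains -/

/-- A directed complete partial order: every non-empty directed set has a least upper bound. -/
def IsDcpo (D : Type*) [PartialOrder D] : Prop :=
  ∀ S : Set D, S.Nonempty → DirectedOn (· ≤ ·) S → ∃ s, IsLUB S s

/-- The way-below relation `x ≪ y`. -/
def WayBelow {D : Type*} [PartialOrder D] (x y : D) : Prop :=
  ∀ S : Set D, S.Nonempty → DirectedOn (· ≤ ·) S →
    ∀ s, IsLUB S s → y ≤ s → ∃ z ∈ S, x ≤ z

/-- `B` is a basis: for every `x`, the set of elements of `B` that are way below `x` is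
(non-empty and) directed, with least upper bound `x`. -/
def IsDomainBasis {D : Type*} [PartialOrder D] (B : Set D) : Prop :=
  ∀ x : D, (B ∩ {z | WayBelow z x}).Nonempty ∧
    DirectedOn (· ≤ ·) (B ∩ {z | WayBelow z x}) ∧ IsLUB (B ∩ {z | WayBelow z x}) x

/-- An effective `ω`-continuous domain: a dcpo with an enumerated basis `(b n)` (repetitions
allowed) for which `{(i, j) | b j ≪ b i}` is computably enumerable. -/
structure EffectiveOmegaContinuousDomain (D : Type*) [PartialOrder D] where
  isDcpo : IsDcpo D
  b : ℕ → D
  isDomainBasis : IsDomainBasis (range b)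
  re_wayBelow : REPred fun p : ℕ × ℕ => WayBelow (b p.2) (b p.1)

/-! ### Effective topological spaces and the effective classes -/

/-- An effective topological space: a space with an enumeration (not necessarily injective) of
some topological basis. -/
structure EffectiveTopologicalSpace (E : Type*) [TopologicalSpace E] where
  O : ℕ → Set E
  isTopologicalBasis : TopologicalSpace.IsTopologicalBasis (range O)

/-- Two ordinals `λ + m` and `μ + n` (`λ`, `μ` zero or limit, `m`, `n` finite) have the same
parity when `m` and `n` do. Since `2 * λ = λ` for such `λ`, the remainder of the (left) division
of `λ + m` by `2` is that of `m`. -/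
def OrdinalSameParity (α β : Ordinal.{0}) : Prop := α % 2 = β % 2

/-- `r` is (the non-strict relation of) a well-order of type `α`, on `ℕ` or on a finite initial
segment of `ℕ`, and `φ` is the isomorphism from its domain `{n | r n n}` onto `α`. -/
structure IsOrdinalIso (r : ℕ → ℕ → Prop) (φ : ℕ → Ordinal.{0}) (α : Ordinal.{0}) : Prop where
  dom_eq : {n | r n n} = univ ∨ ∃ k : ℕ, {n | r n n} = Iio k
  mem_dom : ∀ m n, r m n → r m m ∧ r n n
  bijOn : BijOn φ {n | r n n} (Iio α)
  le_iff : ∀ m n, r m m → r n n → (r m n ↔ φ m ≤ φ n)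

namespace EffectiveTopologicalSpace

variable {E : Type*} [TopologicalSpace E] (T : EffectiveTopologicalSpace E)

/-- Uniformly `Σ⁰₁` sequences: unions of basic sets, with uniformly computably enumerable sets of
indices. -/
def UniformlySigma1 (X : ℕ → Set E) : Prop :=
  ∃ I : ℕ → Set ℕ, REPred (fun p : ℕ × ℕ => p.2 ∈ I p.1) ∧ ∀ n, X n = ⋃ i ∈ I n, T.O i

/-- Uniformly `Π⁰₁` sequences. -/
def UniformlyPi1 (X : ℕ → Set E) : Prop := T.UniformlySigma1 fun n => (X n)ᶜ

/-- The effective class `G_δ(E)`. -/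
def Gdelta : Set (Set E) := {X | ∃ U : ℕ → Set E, T.UniformlySigma1 U ∧ X = ⋂ n, U n}

/-- The effective class `F_σ(E)`. -/
def Fsigma : Set (Set E) := {X | ∃ F : ℕ → Set E, T.UniformlyPi1 F ∧ X = ⋃ n, F n}

/-- The effective class `Σ⁰₂(E)`: effective unions of differences of effectively open sets. (In
spaces that are not metrizable this is in general larger than `F_σ(E)`.) -/
def Sigma2 : Set (Set E) :=
  {X | ∃ U V : ℕ → Set E, T.UniformlySigma1 U ∧ T.UniformlySigma1 V ∧ X = ⋃ n, U n \ V n}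

/-- The effective class `Π⁰₂(E)`. -/
def Pi2 : Set (Set E) := {X | Xᶜ ∈ T.Sigma2}

/-- The effective class `Δ⁰₂(E)`. -/
def Delta2 : Set (Set E) := T.Sigma2 ∩ T.Pi2

/-- The effective Hausdorff class `D_α(E)`: sets of the form
`⋃_{β < α, β ≁ α} A_β \ ⋃_{γ < β} A_γ`, where the sequence `(A_β)_{β < α}` is given through a
computable well-order `r` of type `α` whose set `P` of elements of rank of parity different from
that of `α` is computable, and through a uniformly `Σ⁰₁` sequence `(A n)`, the set `A n` being the
one at position `φ n`. -/
def Hausdorff (α : Ordinal.{0}) : Set (Set E) :=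
  {X | ∃ (r : ℕ → ℕ → Prop) (φ : ℕ → Ordinal.{0}) (P : Set ℕ) (A : ℕ → Set E),
    IsOrdinalIso r φ α ∧
    P = {n | r n n ∧ ¬ OrdinalSameParity (φ n) α} ∧
    ComputablePred (fun p : ℕ × ℕ => r p.1 p.2) ∧
    ComputablePred (fun n => n ∈ P) ∧
    T.UniformlySigma1 A ∧
    X = ⋃ p ∈ P, A p \ ⋃ q ∈ {q | r q q ∧ φ q < φ p}, A q}

end EffectiveTopologicalSpace

/-! ### The effective topological space of an effective `ω`-continuous domain -/

section ScottBasis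

variable {D : Type*} [PartialOrder D]

theorem WayBelow.le {x y : D} (h : WayBelow x y) : x ≤ y := by
  obtain ⟨z, hz, hxz⟩ := h {y} (singleton_nonempty y)
    (by rintro a rfl b rfl; exact ⟨_, rfl, le_rfl, le_rfl⟩) y isLUB_singleton le_rfl
  rw [mem_singleton_iff] at hz
  exact hz ▸ hxz

theorem WayBelow.mono {x x' y y' : D} (h : WayBelow x y) (hx : x' ≤ x) (hy : y ≤ y') :
    WayBelow x' y' := by
  intro S h1 h2 s h3 h4
  obtain ⟨z, hz, hxz⟩ := h S h1 h2 s h3 (hy.trans h4)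
  exact ⟨z, hz, hx.trans hxz⟩

/-- Interpolation. -/
theorem IsDomainBasis.exists_between {B : Set D} (hB : IsDomainBasis B) {x y : D}
    (h : WayBelow x y) : ∃ z ∈ B, WayBelow x z ∧ WayBelow z y := by
  let S : Set D := {u | u ∈ B ∧ ∃ z ∈ B, WayBelow u z ∧ WayBelow z y}
  have hne : S.Nonempty := by
    obtain ⟨z, hz, hzy⟩ := (hB y).1
    obtain ⟨u, hu, huz⟩ := (hB z).1
    exact ⟨u, hu, z, hz, huz, hzy⟩
  have hdir : DirectedOn (· ≤ ·) S := by
    rintro u ⟨hu, z, hz, huz, hzy⟩ u' ⟨hu', z', hz', huz', hzy'⟩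
    obtain ⟨w, ⟨hw, hwy⟩, hzw, hzw'⟩ := (hB y).2.1 z ⟨hz, hzy⟩ z' ⟨hz', hzy'⟩
    obtain ⟨v, ⟨hv, hvw⟩, h1, h2⟩ := (hB w).2.1 u ⟨hu, huz.mono le_rfl hzw⟩ u'
      ⟨hu', huz'.mono le_rfl hzw'⟩
    exact ⟨v, ⟨hv, w, hw, hvw, hwy⟩, h1, h2⟩
  have hlub : IsLUB S y := by
    constructor
    · rintro u ⟨_, z, _, huz, hzy⟩
      exact huz.le.trans hzy.le
    · intro t ht
      refine (hB y).2.2.2 ?_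
      rintro z ⟨hz, hzy⟩
      refine (hB z).2.2.2 ?_
      rintro u ⟨hu, huz⟩
      exact ht ⟨hu, z, hz, huz, hzy⟩
  obtain ⟨u, ⟨_, z, hz, huz, hzy⟩, hxu⟩ := h S hne hdir y hlub le_rfl
  exact ⟨z, hz, huz.mono hxu le_rfl, hzy⟩

theorem EffectiveOmegaContinuousDomain.isTopologicalBasis [TopologicalSpace D]
    [Topology.IsScott D univ] (C : EffectiveOmegaContinuousDomain D) :
    TopologicalSpace.IsTopologicalBasis (range fun n => {x | WayBelow (C.b n) x}) := by
  refine TopologicalSpace.isTopologicalBasis_of_isOpen_of_nhds ?_ ?_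
  · rintro _ ⟨n, rfl⟩
    rw [Topology.IsScott.isOpen_iff_isUpperSet_and_dirSupInaccOn (D := univ)]
    refine ⟨fun x y hxy hx => WayBelow.mono hx le_rfl hxy, ?_⟩
    intro S _ hne hdir s hs hmem
    obtain ⟨z, _, hbz, hzs⟩ := C.isDomainBasis.exists_between hmem
    obtain ⟨w, hw, hzw⟩ := hzs S hne hdir s hs le_rfl
    exact ⟨w, hw, hbz.mono le_rfl hzw⟩
  · intro x U hx hU
    rw [Topology.IsScott.isOpen_iff_isUpperSet_and_dirSupInaccOn (D := univ)] at hU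
    obtain ⟨hne, hdir, hlub⟩ := C.isDomainBasis x
    obtain ⟨z, ⟨⟨n, rfl⟩, hzx⟩, hzU⟩ := hU.2 (mem_univ _) hne hdir hlub hx
    exact ⟨_, ⟨n, rfl⟩, hzx, fun y hy => hU.1 (WayBelow.le hy) hzU⟩

/-- An effective `ω`-continuous domain with its Scott topology, as an effective topological space:
the `n`-th basic open set is the set of points that `b n` is way below. -/
def EffectiveOmegaContinuousDomain.toEffectiveTopologicalSpace [TopologicalSpace D]
    [Topology.IsScott D univ] (C : EffectiveOmegaContinuousDomain D) :
    EffectiveTopologicalSpace D where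
  O n := {x | WayBelow (C.b n) x}
  isTopologicalBasis := C.isTopologicalBasis

end ScottBasis

/-! For the first inclusion, let X be both the intersection of (U n) and the union of (F n).
Interleave the U n, at even places, with the complements of the F n, at odd places, each repeated
infinitely often, into one effective sequence of open sets (W k). Every point leaves W k for
arbitrarily large k, and a point outside W k is in X exactly when k is odd.

Approximate points by finite ≪-increasing chains of basis elements whose levels go up by one, each
element after the first lying in the W of its level. An infinite chain would have a supremum lying
in W k for all large k, which is impossible. So the tree of chains is well-founded
(`wellFounded_step`), and its Kleene–Brouwer order is a well-order (`isWellOrder_codeLT`). It is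
computable because chains carry witnesses for the enumerable relations.

To each chain attach the basic open set of its last element, at level k. Among the sets containing
x, take the earliest. Were x in W (k + 1), the chain could be extended towards x, and extensions
come earlier. So x is not in W (k + 1), and the parity of k + 1 decides whether x is in X. Doubling
the order provides a place of each parity for every chain, which gives X as a difference set
(`exists_mem_hausdorff`).

For the second inclusion, each point of the union of the A p lies in exactly one difference, that of
least rank. The complement is thus the union of the differences of the other parity and of the
outside of all A p (`hausdorff_subset_delta2`). -/

/-! ### Closure properties of enumerable and computable predicates -/

section RecursivelyEnumerable

variable {α β : Type*} [Primcodable α] [Primcodable β]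

/-- A recursively enumerable predicate is a projection of a primitive recursive relation. -/
theorem REPred.exists_primrecRel {p : α → Prop} (hp : REPred p) :
    ∃ q : α → ℕ → Prop, PrimrecRel q ∧ ∀ a, p a ↔ ∃ w, q a w := by
  obtain ⟨c, hc⟩ := Nat.Partrec.Code.exists_code.1 hp
  refine ⟨fun a w => (Nat.Partrec.Code.evaln w c (Encodable.encode a)).isSome = true, ?_, ?_⟩
  · refine PrimrecPred.primrecRel (p := fun x : α × ℕ =>
      (Nat.Partrec.Code.evaln x.2 c (Encodable.encode x.1)).isSome = true) ?_
    refine Primrec.primrecPred (Primrec.of_eq ?_ fun a => (Bool.decide_coe _).symm)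
    exact Primrec.option_isSome.comp (Nat.Partrec.Code.primrec_evaln.comp
      (Primrec.pair (Primrec.pair Primrec.snd (Primrec.const c)) (Primrec.encode.comp Primrec.fst)))
  · intro a
    have h1 : p a ↔ (Nat.Partrec.Code.eval c (Encodable.encode a)).Dom := by
      rw [hc]
      simp [Part.assert]
    rw [h1, Part.dom_iff_mem]
    simp only [Nat.Partrec.Code.evaln_complete, Option.isSome_iff_exists, Option.mem_def]
    exact exists_comm

/-- Unbounded search for a witness halts exactly when there is one. -/
theorem REPred.of_exists {q : α → ℕ → Prop} (hq : ComputablePred fun x : α × ℕ => q x.1 x.2) :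
    REPred fun a => ∃ w, q a w := by
  classical
  have hf : Partrec fun a => Nat.rfind (fun w => Part.some (decide (q a w)) : ℕ →. Bool) :=
    Partrec.rfind (Computable.partrec (ComputablePred.decide hq)).to₂
  refine hf.dom_re.of_eq fun a => Nat.rfind_dom.trans ?_
  simp

theorem REPred.comp {p : β → Prop} (hp : REPred p) {f : α → β} (hf : Computable f) :
    REPred fun a => p (f a) :=
  Partrec.comp hp hf

theorem REPred.and {p q : α → Prop} (hp : REPred p) (hq : REPred q) :
    REPred fun a => p a ∧ q a := by
  obtain ⟨p', hp', hp⟩ := hp.exists_primrecRel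
  obtain ⟨q', hq', hq⟩ := hq.exists_primrecRel
  have h : PrimrecPred fun x : α × ℕ => p' x.1 x.2.unpair.1 ∧ q' x.1 x.2.unpair.2 :=
    (hp'.comp Primrec.fst (Primrec.fst.comp (Primrec.unpair.comp Primrec.snd))).and
      (hq'.comp Primrec.fst (Primrec.snd.comp (Primrec.unpair.comp Primrec.snd)))
  refine (REPred.of_exists (q := fun a w => p' a w.unpair.1 ∧ q' a w.unpair.2)
    h.computablePred).of_eq fun a => ?_
  rw [hp, hq]
  constructor
  · rintro ⟨w, h1, h2⟩
    exact ⟨⟨_, h1⟩, ⟨_, h2⟩⟩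
  · rintro ⟨⟨v, h1⟩, ⟨w, h2⟩⟩
    exact ⟨Nat.pair v w, by simpa using h1, by simpa using h2⟩

theorem REPred.or {p q : α → Prop} (hp : REPred p) (hq : REPred q) :
    REPred fun a => p a ∨ q a := by
  obtain ⟨p', hp', hp⟩ := hp.exists_primrecRel
  obtain ⟨q', hq', hq⟩ := hq.exists_primrecRel
  have h : PrimrecPred fun x : α × ℕ => p' x.1 x.2 ∨ q' x.1 x.2 :=
    (hp'.comp Primrec.fst Primrec.snd).or (hq'.comp Primrec.fst Primrec.snd)
  refine (REPred.of_exists (q := fun a w => p' a w ∨ q' a w) h.computablePred).of_eq fun a => ?_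
  rw [hp, hq, exists_or]

theorem REPred.exists_nat {p : α → ℕ → Prop} (hp : REPred fun x : α × ℕ => p x.1 x.2) :
    REPred fun a => ∃ n, p a n := by
  obtain ⟨q, hq, hpq⟩ := hp.exists_primrecRel
  have h : PrimrecPred fun x : α × ℕ => q (x.1, x.2.unpair.1) x.2.unpair.2 :=
    hq.comp (Primrec.pair Primrec.fst (Primrec.fst.comp (Primrec.unpair.comp Primrec.snd)))
      (Primrec.snd.comp (Primrec.unpair.comp Primrec.snd))
  refine (REPred.of_exists (q := fun a w => q (a, w.unpair.1) w.unpair.2)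
    h.computablePred).of_eq fun a => ?_
  constructor
  · rintro ⟨w, hw⟩
    exact ⟨_, (hpq (a, w.unpair.1)).2 ⟨_, hw⟩⟩
  · rintro ⟨n, hn⟩
    obtain ⟨w, hw⟩ := (hpq (a, n)).1 hn
    exact ⟨Nat.pair n w, by simpa using hw⟩

theorem ComputablePred.comp {p : β → Prop} (hp : ComputablePred p) {f : α → β}
    (hf : Computable f) : ComputablePred fun a => p (f a) := by
  classical
  exact Computable.computablePred (hp.decide.comp hf)

theorem ComputablePred.and {p q : α → Prop} (hp : ComputablePred p) (hq : ComputablePred q) :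
    ComputablePred fun a => p a ∧ q a := by
  classical
  refine Computable.computablePred ((Primrec.and.to_comp.comp hp.decide hq.decide).of_eq
    fun a => ?_)
  simp

end RecursivelyEnumerable

/-! ### Effectively open sets, and difference sets are Δ⁰₂ -/

namespace EffectiveTopologicalSpace

variable {E : Type*} [TopologicalSpace E] (T : EffectiveTopologicalSpace E)

theorem uniformlySigma1_univ : T.UniformlySigma1 fun _ => univ := by
  refine ⟨fun _ => univ, (PrimrecPred.computablePred ?_).to_re, fun n => ?_⟩
  · exact (Primrec.eq.comp (Primrec.const (α := ℕ × ℕ) 0) (Primrec.const 0)).of_eq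
      fun _ => iff_of_true rfl (mem_univ _)
  · rw [biUnion_univ, ← sUnion_range, T.isTopologicalBasis.sUnion_eq]

variable {T}

/-- Uniform effective unions of a uniformly `Σ⁰₁` sequence. -/
theorem UniformlySigma1.biUnion {A : ℕ → Set E} (hA : T.UniformlySigma1 A) {S : ℕ → ℕ → Prop}
    (hS : REPred fun p : ℕ × ℕ => S p.1 p.2) :
    T.UniformlySigma1 fun n => ⋃ q ∈ {q | S n q}, A q := by
  obtain ⟨I, hI, hAI⟩ := hA
  refine ⟨fun n => {i | ∃ q, S n q ∧ i ∈ I q}, ?_, fun n => ?_⟩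
  · refine REPred.exists_nat (α := ℕ × ℕ) (p := fun x q => S x.1 q ∧ x.2 ∈ I q)
      (REPred.and ?_ ?_)
    · exact hS.comp (f := fun x : (ℕ × ℕ) × ℕ => (x.1.1, x.2))
        (Computable.pair (Computable.fst.comp Computable.fst) Computable.snd)
    · exact hI.comp (f := fun x : (ℕ × ℕ) × ℕ => (x.2, x.1.2))
        (Computable.pair Computable.snd (Computable.snd.comp Computable.fst))
  · ext x
    simp only [hAI, mem_iUnion, mem_ofPred_eq, exists_prop]
    constructor
    · rintro ⟨q, hq, i, hi, hx⟩
      exact ⟨i, ⟨q, hq, hi⟩, hx⟩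
    · rintro ⟨i, ⟨q, hq, hi⟩, hx⟩
      exact ⟨q, hq, i, hi, hx⟩

open scoped Classical in
theorem UniformlySigma1.ite {A B : ℕ → Set E} (hA : T.UniformlySigma1 A)
    (hB : T.UniformlySigma1 B) {S : ℕ → Prop} (hS : ComputablePred S) {f g : ℕ → ℕ}
    (hf : Computable f) (hg : Computable g) :
    T.UniformlySigma1 fun n => if S n then A (f n) else B (g n) := by
  obtain ⟨I, hI, hAI⟩ := hA
  obtain ⟨J, hJ, hBJ⟩ := hB
  refine ⟨fun n => {i | (S n ∧ i ∈ I (f n)) ∨ (¬ S n ∧ i ∈ J (g n))},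
    REPred.or (REPred.and ?_ ?_) (REPred.and ?_ ?_), fun n => ?_⟩
  · exact hS.to_re.comp Computable.fst
  · exact hI.comp (Computable.pair (hf.comp Computable.fst) Computable.snd)
  · exact hS.not.to_re.comp Computable.fst
  · exact hJ.comp (Computable.pair (hg.comp Computable.fst) Computable.snd)
  · by_cases h : S n <;> simp [h, hAI, hBJ]

theorem hausdorff_subset_delta2 (α : Ordinal.{0}) : T.Hausdorff α ⊆ T.Delta2 := by
  rintro X ⟨r, φ, P, A, hφ, hP, hr, hPc, hA, rfl⟩
  -- Comparison of ordinal ranks is replaced by a condition on `r`, which is computable.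
  have hlt : ∀ p q, r p p → ((r q q ∧ φ q < φ p) ↔ (r q p ∧ ¬ r p q)) := by
    intro p q hp
    constructor
    · rintro ⟨hq, h⟩
      exact ⟨(hφ.le_iff _ _ hq hp).2 h.le, fun h' => h.not_ge ((hφ.le_iff _ _ hp hq).1 h')⟩
    · rintro ⟨h1, h2⟩
      have hq := (hφ.mem_dom _ _ h1).1
      exact ⟨hq, not_le.1 fun h => h2 ((hφ.le_iff _ _ hp hq).2 h)⟩
  have hdom : ∀ p ∈ P, r p p := fun p hp => by rw [hP] at hp; exact hp.1
  have hrr : ComputablePred fun n => r n n := hr.comp (Computable.pair Computable.id Computable.id)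
  have hV : T.UniformlySigma1 fun p => ⋃ q ∈ {q | r q p ∧ ¬ r p q}, A q := by
    refine hA.biUnion (REPred.and ?_ ?_)
    · exact (hr.comp (Computable.pair Computable.snd Computable.fst)).to_re
    · exact hr.not.to_re
  -- This union is `A p` if `S p` holds and empty otherwise.
  have hsel : ∀ {S : ℕ → Prop}, ComputablePred S →
      T.UniformlySigma1 fun p => ⋃ q ∈ {q | S p ∧ q = p}, A q := by
    intro S hS
    refine hA.biUnion (REPred.and (hS.to_re.comp Computable.fst) ?_)
    exact (Primrec.eq.comp Primrec.snd Primrec.fst).computablePred.to_re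
  refine ⟨⟨_, _, hsel hPc, hV, ?_⟩, ?_⟩
  · ext x
    simp only [mem_iUnion, mem_sdiff, mem_ofPred_eq, exists_prop]
    constructor
    · rintro ⟨p, hp, hx, hn⟩
      refine ⟨p, ⟨p, ⟨hp, rfl⟩, hx⟩, ?_⟩
      rintro ⟨q, hq, hxq⟩
      exact hn ⟨q, (hlt p q (hdom p hp)).2 hq, hxq⟩
    · rintro ⟨p, ⟨_, ⟨hp, rfl⟩, hx⟩, hn⟩
      refine ⟨_, hp, hx, ?_⟩
      rintro ⟨q, hq, hxq⟩
      exact hn ⟨q, (hlt _ q (hdom _ hp)).1 hq, hxq⟩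
  · classical
    -- In the complement, index 0 is reserved for the points outside all `A q`; the difference at
    -- `p` moves to index `p + 1`.
    have hU' := T.uniformlySigma1_univ.ite (hsel (hrr.and hPc.not))
      (Primrec.eq.comp Primrec.id (Primrec.const 0)).computablePred Computable.id
      Primrec.pred.to_comp
    have hall : T.UniformlySigma1 fun _ => ⋃ q ∈ {q | r q q}, A q :=
      hA.biUnion (hrr.to_re.comp Computable.snd)
    have hV' := hall.ite hV (Primrec.eq.comp Primrec.id (Primrec.const 0)).computablePred
      Computable.id Primrec.pred.to_comp
    refine ⟨_, _, hU', hV', ?_⟩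
    ext x
    simp only [mem_compl_iff, mem_iUnion, mem_sdiff, mem_ofPred_eq, exists_prop]
    by_cases hx : ∃ q, r q q ∧ x ∈ A q
    · obtain ⟨p, ⟨hp, hxp⟩, hmin⟩ := exists_minimalFor_of_wellFoundedLT
        (fun q => r q q ∧ x ∈ A q) φ hx
      have hmin' : ∀ q, r q q → x ∈ A q → φ p ≤ φ q := fun q hq hxq => by
        by_contra h
        exact h (hmin ⟨hq, hxq⟩ (not_le.1 h).le)
      have huniq : ∀ q, r q q → x ∈ A q →
          (¬ ∃ q', (r q' q' ∧ φ q' < φ q) ∧ x ∈ A q') → q = p := by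
        intro q hq hxq hn
        refine hφ.bijOn.injOn hq hp (le_antisymm ?_ (hmin' q hq hxq))
        by_contra h
        exact hn ⟨p, ⟨hp, not_le.1 h⟩, hxp⟩
      have hpmin : ¬ ∃ q', (r q' q' ∧ φ q' < φ p) ∧ x ∈ A q' := by
        rintro ⟨q', ⟨h1, h2⟩, h3⟩
        exact h2.not_ge (hmin' q' h1 h3)
      constructor
      · intro hn
        refine ⟨p + 1, ?_, ?_⟩
        · simp only [Nat.pred_succ]
          refine mem_biUnion (x := p) ⟨⟨hp, fun h => hn ⟨p, h, hxp, hpmin⟩⟩, rfl⟩ hxp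
        · simp only [Nat.pred_succ]
          intro h
          obtain ⟨q, hq, hxq⟩ := mem_iUnion₂.1 h
          exact hpmin ⟨q, (hlt p q hp).2 hq, hxq⟩
      · rintro ⟨n, h1, h2⟩ ⟨q, hq, hxq, hn⟩
        obtain rfl := huniq q (hdom q hq) hxq hn
        rcases n with _ | n
        · exact h2 (by simpa using ⟨q, hp, hxp⟩)
        · simp only [Nat.pred_succ] at h1 h2
          obtain ⟨m, ⟨⟨hm, hmP⟩, rfl⟩, hxm⟩ := mem_iUnion₂.1 h1
          refine hmP ((huniq m hm hxm ?_) ▸ hq)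
          rintro ⟨q', hq', hxq'⟩
          exact h2 (mem_biUnion (x := q') ((hlt m q' hm).1 hq') hxq')
    · refine iff_of_true ?_ ⟨0, by simp, by simpa using hx⟩
      rintro ⟨p, hp, hxp, -⟩
      exact hx ⟨p, hdom p hp, hxp⟩

end EffectiveTopologicalSpace

/-! ### Bounded quantification of primitive recursive relations -/

section BoundedQuantifiers

variable {β : Type*} [Primcodable β] {R : ℕ → β → Prop}

theorem primrecRel_forall_lt (hR : PrimrecRel R) : PrimrecRel fun n b => ∀ k < n, R k b :=
  (hR.forall_mem_list.comp (Primrec.list_range.comp Primrec.fst) Primrec.snd).of_eq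
    fun p => by simp

theorem primrecRel_exists_lt (hR : PrimrecRel R) : PrimrecRel fun n b => ∃ k < n, R k b :=
  (hR.exists_mem_list.comp (Primrec.list_range.comp Primrec.fst) Primrec.snd).of_eq
    fun p => by simp

end BoundedQuantifiers

/-! ### The Kleene–Brouwer order on finite sequences -/

namespace KleeneBrouwer

/-- The list `l`, continued by `⊤`. The lexicographic order on such sequences is the
Kleene–Brouwer order, in which a list comes after its proper extensions. -/
def key (l : List ℕ) : Lex (ℕ → WithTop ℕ) := toLex fun k => (l[k]?).elim ⊤ (↑)

theorem key_apply (l : List ℕ) (k : ℕ) : key l k = (l[k]?).elim ⊤ (↑) := rfl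

theorem key_injective : Function.Injective key := by
  intro l m h
  refine List.ext_getElem? fun k => ?_
  have hk := congrFun h k
  rw [key_apply, key_apply] at hk
  rcases h1 : l[k]? with _ | a <;> rcases h2 : m[k]? with _ | b <;> simp_all

/-- At the first difference the smaller sequence cannot have the value `⊤`, so that place is below
`l.length`. All quantifiers become bounded, which makes the order primitive recursive. -/
theorem key_lt_iff {l m : List ℕ} :
    key l < key m ↔ ∃ k < l.length, (∀ j < k, l[j]? = m[j]?) ∧
      (m.length ≤ k ∨ l.getD k 0 < m.getD k 0) := by
  have heq : ∀ j, key l j = key m j ↔ l[j]? = m[j]? := fun j => by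
    rw [key_apply, key_apply]
    rcases h1 : l[j]? with _ | a <;> rcases h2 : m[j]? with _ | b <;> simp
  have hlt : ∀ k, key l k < key m k ↔
      k < l.length ∧ (m.length ≤ k ∨ l.getD k 0 < m.getD k 0) := fun k => by
    rw [key_apply, key_apply]
    by_cases h1 : k < l.length <;> by_cases h2 : k < m.length <;> simp [h1, h2]; omega
  constructor
  · rintro ⟨k, h1, h2⟩
    exact ⟨k, ((hlt k).1 h2).1, fun j hj => (heq j).1 (h1 j hj), ((hlt k).1 h2).2⟩
  · rintro ⟨k, h1, h2, h3⟩
    exact ⟨k, fun j hj => (heq j).2 (h2 j hj), (hlt k).2 ⟨h1, h3⟩⟩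

theorem key_append_singleton_lt (l : List ℕ) (a : ℕ) : key (l ++ [a]) < key l := by
  refine key_lt_iff.2 ⟨l.length, by simp, fun j hj => ?_, Or.inl le_rfl⟩
  rw [List.getElem?_append_left hj]

theorem key_cons_lt_key_nil (a : ℕ) (l : List ℕ) : key (a :: l) < key [] :=
  key_lt_iff.2 ⟨0, by simp, by simp, Or.inl (by simp)⟩

theorem key_cons_lt_key_cons {a b : ℕ} (h : a < b) (l m : List ℕ) : key (a :: l) < key (b :: m) :=
  key_lt_iff.2 ⟨0, by simp, by simp, Or.inr (by simpa)⟩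

theorem key_cons_le_key_cons (a : ℕ) {l m : List ℕ} (h : key l ≤ key m) :
    key (a :: l) ≤ key (a :: m) := by
  rcases h.eq_or_lt with h | h
  · rw [key_injective h]
  · obtain ⟨k, h1, h2, h3⟩ := key_lt_iff.1 h
    refine (key_lt_iff.2 ⟨k + 1, by simpa using h1, fun j hj => ?_, by simpa using h3⟩).le
    rcases j with _ | j
    · simp
    · simpa using h2 j (by omega)

/-- If nonempty sets of tails have least elements, so has a nonempty set of lists. -/
theorem exists_least_of_tails {S : Set (List ℕ)} (hS : S.Nonempty)
    (h : ∀ a, {l | a :: l ∈ S}.Nonempty → ∃ l, a :: l ∈ S ∧ ∀ m, a :: m ∈ S → key l ≤ key m) :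
    ∃ l ∈ S, ∀ m ∈ S, key l ≤ key m := by
  by_cases hne : ∃ a, {l | a :: l ∈ S}.Nonempty
  · obtain ⟨a, ha, hmin⟩ := WellFounded.has_min (wellFounded_lt (α := ℕ))
      {a | {l | a :: l ∈ S}.Nonempty} hne
    obtain ⟨l, hl, hlmin⟩ := h a ha
    refine ⟨_, hl, fun m hm => ?_⟩
    rcases m with _ | ⟨b, m⟩
    · exact (key_cons_lt_key_nil _ _).le
    · rcases (not_lt.1 (hmin b ⟨m, hm⟩)).eq_or_lt with rfl | hab
      · exact key_cons_le_key_cons _ (hlmin m hm)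
      · exact (key_cons_lt_key_cons hab _ _).le
  · have hnil : ∀ m ∈ S, m = [] := by
      intro m hm
      rcases m with _ | ⟨b, m⟩
      · rfl
      · exact absurd ⟨b, m, hm⟩ hne
    obtain ⟨l, hl⟩ := hS
    refine ⟨l, hl, fun m hm => ?_⟩
    rw [hnil l hl, hnil m hm]

/-- Along a well-founded relation, the Kleene–Brouwer order well-orders the chains. -/
theorem exists_least_of_isChain {R : ℕ → ℕ → Prop} (hR : WellFounded (Function.swap R))
    {S : Set (List ℕ)} (hne : S.Nonempty) (hS : ∀ l ∈ S, l.IsChain R) :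
    ∃ l ∈ S, ∀ m ∈ S, key l ≤ key m := by
  -- Well-founded induction on the entry `e` that precedes the lists: their heads are `R`-successors
  -- of `e`.
  have main : ∀ e, ∀ S : Set (List ℕ), S.Nonempty → (∀ l ∈ S, (e :: l).IsChain R) →
      ∃ l ∈ S, ∀ m ∈ S, key l ≤ key m := by
    intro e
    induction e using hR.induction with
    | _ e ih =>
      intro S hne hS
      refine exists_least_of_tails hne fun a ha => ?_
      obtain ⟨l, hl⟩ := id ha
      exact ih a (List.isChain_cons_cons.1 (hS _ hl)).1 _ ha
        fun l hl => (List.isChain_cons_cons.1 (hS _ hl)).2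
  exact exists_least_of_tails hne fun a ha => main a _ ha fun l hl => hS _ hl

open scoped Classical in
/-- Chains come first, in the Kleene–Brouwer order, followed by the other lists in the order of
their codes. -/
noncomputable def chainKey (R : ℕ → ℕ → Prop) (l : List ℕ) : Lex (ℕ → WithTop ℕ) ⊕ₗ ℕ :=
  if l.IsChain R then Sum.inlₗ (key l) else Sum.inrₗ (Encodable.encode l)

theorem chainKey_injective (R : ℕ → ℕ → Prop) : Function.Injective (chainKey R) := by
  intro l m h
  by_cases hl : l.IsChain R <;> by_cases hm : m.IsChain R <;> simp only [chainKey, hl, hm] at h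
  · exact key_injective (by simpa [Sum.inlₗ] using h)
  · simp [Sum.inlₗ, Sum.inrₗ] at h
  · simp [Sum.inlₗ, Sum.inrₗ] at h
  · exact Encodable.encode_injective (by simpa [Sum.inrₗ] using h)

theorem chainKey_lt_iff {R : ℕ → ℕ → Prop} {l m : List ℕ} :
    chainKey R l < chainKey R m ↔ (l.IsChain R ∧ (¬ m.IsChain R ∨ key l < key m)) ∨
      (¬ l.IsChain R ∧ ¬ m.IsChain R ∧ Encodable.encode l < Encodable.encode m) := by
  by_cases hl : l.IsChain R <;> by_cases hm : m.IsChain R <;> simp [chainKey, hl, hm]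

/-- The list coded by a number. -/
def ofCode (n : ℕ) : List ℕ := Denumerable.ofNat (List ℕ) n

/-- The order of lists by `chainKey`, transported to their codes. -/
def codeLT (R : ℕ → ℕ → Prop) (m n : ℕ) : Prop := chainKey R (ofCode m) < chainKey R (ofCode n)

/-- A set containing codes of chains has its least element among them, by the Kleene–Brouwer
argument; otherwise the order on it is that of the numbers. Keeping the codes of non-chains makes ℕ
the whole domain. -/
theorem isWellOrder_codeLT {R : ℕ → ℕ → Prop} (hR : WellFounded (Function.swap R)) :
    IsWellOrder ℕ (codeLT R) := by
  have hinj : Function.Injective fun n => chainKey R (ofCode n) :=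
    (chainKey_injective R).comp (Denumerable.eqv (List ℕ)).symm.injective
  have hwf : WellFounded (codeLT R) := by
    refine WellFounded.wellFounded_iff_has_min.2 fun S hS => ?_
    by_cases hc : ∃ n ∈ S, (ofCode n).IsChain R
    · obtain ⟨n, hn, hnc⟩ := hc
      obtain ⟨_, ⟨n, ⟨hn, hc⟩, rfl⟩, hmin⟩ := exists_least_of_isChain hR
        (S := ofCode '' {n | n ∈ S ∧ (ofCode n).IsChain R}) ⟨_, n, ⟨hn, hnc⟩, rfl⟩
        (by rintro _ ⟨n, ⟨-, h⟩, rfl⟩; exact h)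
      refine ⟨n, hn, fun m hm hlt => ?_⟩
      rcases chainKey_lt_iff.1 hlt with ⟨h1, h2 | h2⟩ | ⟨-, h, -⟩
      · exact h2 hc
      · exact h2.not_ge (hmin _ ⟨m, ⟨hm, h1⟩, rfl⟩)
      · exact h hc
    · obtain ⟨n, hn, hmin⟩ := WellFounded.has_min (wellFounded_lt (α := ℕ)) S hS
      refine ⟨n, hn, fun m hm hlt => ?_⟩
      rcases chainKey_lt_iff.1 hlt with ⟨h1, -⟩ | ⟨-, -, h⟩
      · exact hc ⟨m, hm, h1⟩
      · exact hmin m hm (by simpa [ofCode] using h)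
  exact
    { wf := hwf
      trichotomous := fun a b h1 h2 => hinj (le_antisymm (not_lt.1 h2) (not_lt.1 h1))
  }

theorem primrec_ofCode : Primrec ofCode := by
  refine Primrec.option_some_iff.1 (Primrec.decode.of_eq fun n => ?_)
  exact Denumerable.decode_eq_ofNat _ n

theorem primrecPred_isChain {R : ℕ → ℕ → Prop} (hR : PrimrecRel R) :
    PrimrecPred fun l : List ℕ => l.IsChain R := by
  -- The default 0 is never read, since `k` will range below `l.length - 1`.
  have h : PrimrecRel fun (k : ℕ) (l : List ℕ) => R (l.getD k 0) (l.getD (k + 1) 0) :=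
    hR.comp ((Primrec.list_getD 0).comp Primrec.snd Primrec.fst)
      ((Primrec.list_getD 0).comp Primrec.snd (Primrec.succ.comp Primrec.fst))
  refine (PrimrecRel.comp (primrecRel_forall_lt h) (Primrec.pred.comp Primrec.list_length)
    Primrec.id).of_eq fun l => ?_
  rw [List.isChain_iff_getElem]
  constructor
  · intro h k hk
    have := h k (by simp; omega)
    simpa [List.getD_eq_getElem, hk, (Nat.lt_succ_self k).trans hk] using this
  · intro h k hk
    have hk' : k + 1 < l.length := by simp at hk; omega
    simpa [List.getD_eq_getElem, hk', (Nat.lt_succ_self k).trans hk'] using h k hk'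

theorem primrecRel_key_lt : PrimrecRel fun l m : List ℕ => key l < key m := by
  have h1 : PrimrecRel fun (j : ℕ) (p : List ℕ × List ℕ) => p.1[j]? = p.2[j]? :=
    Primrec.eq.comp (Primrec.list_getElem?.comp (Primrec.fst.comp Primrec.snd) Primrec.fst)
      (Primrec.list_getElem?.comp (Primrec.snd.comp Primrec.snd) Primrec.fst)
  have h2 : PrimrecRel fun (k : ℕ) (p : List ℕ × List ℕ) =>
      (∀ j < k, p.1[j]? = p.2[j]?) ∧ (p.2.length ≤ k ∨ p.1.getD k 0 < p.2.getD k 0) :=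
    PrimrecPred.and (p := fun x : ℕ × List ℕ × List ℕ => ∀ j < x.1, x.2.1[j]? = x.2.2[j]?)
      (primrecRel_forall_lt h1) ((Primrec.nat_le.comp
      (Primrec.list_length.comp (Primrec.snd.comp Primrec.snd)) Primrec.fst).or
      (Primrec.nat_lt.comp
        ((Primrec.list_getD 0).comp (Primrec.fst.comp Primrec.snd) Primrec.fst)
        ((Primrec.list_getD 0).comp (Primrec.snd.comp Primrec.snd) Primrec.fst)))
  refine (PrimrecRel.comp (primrecRel_exists_lt h2) (Primrec.list_length.comp Primrec.fst)
    Primrec.id).of_eq fun p => ?_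
  exact key_lt_iff.symm

theorem primrecRel_codeLT {R : ℕ → ℕ → Prop} (hR : PrimrecRel R) : PrimrecRel (codeLT R) := by
  have hc := primrecPred_isChain hR
  have h1 := primrec_ofCode.comp (Primrec.fst (α := ℕ) (β := ℕ))
  have h2 := primrec_ofCode.comp (Primrec.snd (α := ℕ) (β := ℕ))
  refine (((hc.comp h1).and ((hc.comp h2).not.or (primrecRel_key_lt.comp h1 h2))).or
    ((hc.comp h1).not.and ((hc.comp h2).not.and
      (Primrec.nat_lt.comp (Primrec.encode.comp h1) (Primrec.encode.comp h2))))).of_eq fun p => ?_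
  exact chainKey_lt_iff.symm

end KleeneBrouwer

/-! ### Doubling a well-order -/

section Ordinal

open Ordinal

/-- The order in which each point `k` of a well-order is replaced by the pair `2 * k < 2 * k + 1`. -/
def doubleLE (s : ℕ → ℕ → Prop) (m n : ℕ) : Prop :=
  s (m / 2) (n / 2) ∨ (m / 2 = n / 2 ∧ m ≤ n)

/-- The position of `n` in `doubleLE s`. -/
noncomputable def doubleRank (s : ℕ → ℕ → Prop) [IsWellOrder ℕ s] (n : ℕ) : Ordinal.{0} :=
  2 * typein s (n / 2) + (n % 2 : ℕ)

variable (s : ℕ → ℕ → Prop) [IsWellOrder ℕ s]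

theorem natCast_mod_two_lt_two (n : ℕ) : ((n % 2 : ℕ) : Ordinal.{0}) < 2 := by
  exact_mod_cast Nat.mod_lt n two_pos

theorem doubleRank_mod_two (n : ℕ) : doubleRank s n % 2 = (n % 2 : ℕ) := by
  rw [doubleRank, mul_add_mod_self, mod_eq_of_lt (natCast_mod_two_lt_two n)]

theorem doubleRank_div_two (n : ℕ) : doubleRank s n / 2 = typein s (n / 2) := by
  rw [doubleRank, mul_add_div _ two_ne_zero, div_eq_zero_of_lt (natCast_mod_two_lt_two n), add_zero]

theorem doubleRank_lt_iff {m n : ℕ} :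
    doubleRank s m < doubleRank s n ↔ s (m / 2) (n / 2) ∨ (m / 2 = n / 2 ∧ m < n) := by
  have key : ∀ {m n : ℕ}, s (m / 2) (n / 2) → doubleRank s m < doubleRank s n := by
    intro m n h
    rw [← typein_lt_typein s] at h
    have h2 : 2 * Order.succ (typein s (m / 2)) ≤ 2 * typein s (n / 2) :=
      mul_le_mul_right (Order.succ_le_of_lt h) 2
    refine lt_of_lt_of_le ?_ (h2.trans le_self_add)
    rw [doubleRank, mul_succ]
    exact (add_lt_add_iff_left _).2 (natCast_mod_two_lt_two m)
  rcases trichotomous_of s (m / 2) (n / 2) with h | h | h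
  · exact iff_of_true (key h) (Or.inl h)
  · simp only [doubleRank, h, irrefl, add_lt_add_iff_left, Nat.cast_lt, false_or, true_and]
    omega
  · refine iff_of_false (key h).not_gt ?_
    rintro (h' | ⟨h', -⟩)
    · exact asymm h h'
    · rw [h'] at h
      exact irrefl _ h

/-- Division by 2 with remainder inverts the ranking: the quotient of an ordinal below `2 * type s`
is the rank of a point of `s`, and the remainder selects one of its two copies. -/
theorem isOrdinalIso_double : IsOrdinalIso (doubleLE s) (doubleRank s) (2 * type s) where
  dom_eq := Or.inl (eq_univ_of_forall fun _ => Or.inr ⟨rfl, le_rfl⟩)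
  mem_dom _ _ _ := ⟨Or.inr ⟨rfl, le_rfl⟩, Or.inr ⟨rfl, le_rfl⟩⟩
  bijOn := by
    refine ⟨fun n _ => ?_, fun m _ n _ h => ?_, fun o ho => ?_⟩
    · exact (lt_mul_iff_div_lt two_ne_zero).2 (doubleRank_div_two s n ▸ typein_lt_type s _)
    · have h1 : typein s (m / 2) = typein s (n / 2) := by
        rw [← doubleRank_div_two, ← doubleRank_div_two, h]
      have h2 : ((m % 2 : ℕ) : Ordinal.{0}) = (n % 2 : ℕ) := by
        rw [← doubleRank_mod_two s, ← doubleRank_mod_two s, h]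
      have h3 := (typein_inj s).1 h1
      have h4 : m % 2 = n % 2 := by exact_mod_cast h2
      omega
    · obtain ⟨k, hk⟩ := typein_surj s ((lt_mul_iff_div_lt two_ne_zero).1 ho)
      obtain ⟨i, hi⟩ := lt_omega0.1 ((mod_lt o two_ne_zero).trans (natCast_lt_omega0 2))
      have hi2 : i < 2 := by
        have := mod_lt o (b := 2) two_ne_zero
        rw [hi] at this
        exact_mod_cast this
      refine ⟨2 * k + i, Or.inr ⟨rfl, le_rfl⟩, ?_⟩
      rw [doubleRank, show (2 * k + i) / 2 = k by omega, show (2 * k + i) % 2 = i by omega, hk,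
        ← hi, div_add_mod]
  le_iff m n _ _ := by
    rw [← not_lt, doubleRank_lt_iff, doubleLE]
    rcases trichotomous_of s (m / 2) (n / 2) with h | h | h
    · refine iff_of_true (Or.inl h) ?_
      rintro (h' | ⟨h', -⟩)
      · exact asymm h h'
      · exact irrefl _ (h' ▸ h)
    · simp only [h, irrefl, false_or, true_and, not_lt]
    · refine iff_of_false ?_ (fun h' => h' (Or.inl h))
      rintro (h' | ⟨h', -⟩)
      · exact asymm h h'
      · exact irrefl _ (h' ▸ h)

theorem two_mul_type_mem_Ico : 2 * type s ∈ Ico (1 : Ordinal.{0}) (ω_ 1) := by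
  refine ⟨?_, ?_⟩
  · rw [Order.one_le_iff_pos]
    exact mul_pos two_pos (_root_.pos_iff_ne_zero.2 (type_ne_zero_of_nonempty s))
  · rw [← Cardinal.ord_aleph, Cardinal.lt_ord, card_mul, card_type]
    simp

end Ordinal

/-! ### Chains of basis elements in an effective domain -/

namespace EffectiveOmegaContinuousDomain

variable {D : Type*} [PartialOrder D] [TopologicalSpace D] [Topology.IsScott D univ]
  (C : EffectiveOmegaContinuousDomain D)

theorem mem_O {n : ℕ} {x : D} :
    x ∈ C.toEffectiveTopologicalSpace.O n ↔ WayBelow (C.b n) x := Iff.rfl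

/-- Membership of a basis element means that some enumerated basic index lies way below it, and ≪ is
enumerable on the basis. -/
theorem rePred_mem_of_uniformlySigma1 {W : ℕ → Set D}
    (hW : C.toEffectiveTopologicalSpace.UniformlySigma1 W) :
    REPred fun p : ℕ × ℕ => C.b p.2 ∈ W p.1 := by
  obtain ⟨I, hI, hWI⟩ := hW
  have h : REPred fun x : (ℕ × ℕ) × ℕ => x.2 ∈ I x.1.1 ∧ WayBelow (C.b x.2) (C.b x.1.2) :=
    (hI.comp (Computable.pair (Computable.fst.comp Computable.fst) Computable.snd)).and
      (C.re_wayBelow.comp (Computable.pair (Computable.snd.comp Computable.fst) Computable.snd))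
  refine (REPred.exists_nat (p := fun x n => n ∈ I x.1 ∧ WayBelow (C.b n) (C.b x.2)) h).of_eq
    fun p => ?_
  simp [hWI, mem_O]

theorem mem_of_le {W : ℕ → Set D} (hW : C.toEffectiveTopologicalSpace.UniformlySigma1 W) {k : ℕ}
    {x y : D} (hx : x ∈ W k) (hxy : x ≤ y) : y ∈ W k := by
  obtain ⟨I, -, hWI⟩ := hW
  simp only [hWI, mem_iUnion, mem_O] at hx ⊢
  obtain ⟨i, hi, h⟩ := hx
  exact ⟨i, hi, h.mono le_rfl hxy⟩

/-- A point of an effectively open set is approximated by basis elements of that set, from any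
given stage of approximation on. -/
theorem exists_wayBelow_of_mem {W : ℕ → Set D}
    (hW : C.toEffectiveTopologicalSpace.UniformlySigma1 W) {k i : ℕ} {x : D} (hx : x ∈ W k)
    (hi : WayBelow (C.b i) x) :
    ∃ j, WayBelow (C.b i) (C.b j) ∧ C.b j ∈ W k ∧ WayBelow (C.b j) x := by
  obtain ⟨I, -, hWI⟩ := hW
  simp only [hWI, mem_iUnion, mem_O] at hx ⊢
  obtain ⟨m, hm, hmx⟩ := hx
  obtain ⟨u, hu, hmu, hux⟩ := C.isDomainBasis.exists_between hmx
  obtain ⟨v, hv, hiv, hvx⟩ := C.isDomainBasis.exists_between hi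
  obtain ⟨_, ⟨⟨j, rfl⟩, hjx⟩, huj, hvj⟩ := (C.isDomainBasis x).2.1 u ⟨hu, hux⟩ v ⟨hv, hvx⟩
  exact ⟨j, hiv.mono le_rfl hvj, ⟨m, hm, hmu.mono le_rfl huj⟩, hjx⟩

/-- The number `e` as a code of the triple of a level, an index of a basis element, and a
witness. -/
def level (e : ℕ) : ℕ := e.unpair.1

def index (e : ℕ) : ℕ := e.unpair.2.unpair.1

def witness (e : ℕ) : ℕ := e.unpair.2.unpair.2

def code (k i w : ℕ) : ℕ := Nat.pair k (Nat.pair i w)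

@[simp] theorem level_code (k i w : ℕ) : level (code k i w) = k := by simp [level, code]

@[simp] theorem index_code (k i w : ℕ) : index (code k i w) = i := by simp [index, code]

@[simp] theorem witness_code (k i w : ℕ) : witness (code k i w) = w := by simp [witness, code]

theorem primrec_level : Primrec level := Primrec.fst.comp Primrec.unpair

theorem primrec_index : Primrec index :=
  Primrec.fst.comp (Primrec.unpair.comp (Primrec.snd.comp Primrec.unpair))

theorem primrec_witness : Primrec witness :=
  Primrec.snd.comp (Primrec.unpair.comp (Primrec.snd.comp Primrec.unpair))

/-- Chains of this relation are sequences of basis elements that increase for `≪`, the one at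
level `k` being in the `k`-th of a given sequence of sets, as witnessed by `q`. -/
def Step (q : ℕ × ℕ × ℕ → ℕ → Prop) (e e' : ℕ) : Prop :=
  level e' = level e + 1 ∧ q (level e', index e, index e') (witness e')

theorem primrecRel_step {q : ℕ × ℕ × ℕ → ℕ → Prop} (hq : PrimrecRel q) : PrimrecRel (Step q) :=
  (Primrec.eq.comp (primrec_level.comp Primrec.snd)
    (Primrec.succ.comp (primrec_level.comp Primrec.fst))).and
  (hq.comp (Primrec.pair (primrec_level.comp Primrec.snd)
    (Primrec.pair (primrec_index.comp Primrec.fst) (primrec_index.comp Primrec.snd)))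
    (primrec_witness.comp Primrec.snd))

variable {C}

/-- The supremum of an infinite chain lies above each of its elements. As open sets are upward
closed, it would belong to every `W m` with `m` above the starting level. -/
theorem wellFounded_step {W : ℕ → Set D} (hW : C.toEffectiveTopologicalSpace.UniformlySigma1 W)
    (hWX : ∀ x k, ∃ m, k < m ∧ x ∉ W m) {q : ℕ × ℕ × ℕ → ℕ → Prop}
    (hq : ∀ a : ℕ × ℕ × ℕ, (WayBelow (C.b a.2.1) (C.b a.2.2) ∧ C.b a.2.2 ∈ W a.1) ↔ ∃ w, q a w) :
    WellFounded (Function.swap (Step q)) := by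
  refine wellFounded_iff_isEmpty_descending_chain.2 ⟨fun ⟨f, hf⟩ => ?_⟩
  have hlevel : ∀ n, level (f n) = level (f 0) + n := by
    intro n
    induction n with
    | zero => rfl
    | succ n ih => rw [(hf n).1, ih, add_assoc]
  have hstep : ∀ n, WayBelow (C.b (index (f n))) (C.b (index (f (n + 1)))) ∧
      C.b (index (f (n + 1))) ∈ W (level (f (n + 1))) := fun n =>
    (hq (_, _, _)).2 ⟨_, (hf n).2⟩
  have hmono : Monotone fun n => C.b (index (f n)) :=
    monotone_nat_of_le_succ fun n => (hstep n).1.le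
  obtain ⟨x, hx⟩ := C.isDcpo (range fun n => C.b (index (f n))) (range_nonempty _)
    hmono.directed_le.directedOn_range
  obtain ⟨m, hm, hxm⟩ := hWX x (level (f 0))
  obtain ⟨n, rfl⟩ := Nat.exists_eq_add_of_lt hm
  refine hxm (C.mem_of_le hW ?_ (hx.1 ⟨n + 1, rfl⟩))
  have := (hstep n).2
  rwa [hlevel, ← add_assoc] at this

open KleeneBrouwer in
/-- A set is in the difference hierarchy if its points and those of its complement are
distinguished by the parity of the levels at which they leave an effective sequence of open
sets. -/
theorem exists_mem_hausdorff {W : ℕ → Set D}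
    (hW : C.toEffectiveTopologicalSpace.UniformlySigma1 W)
    (hWX : ∀ x k, ∃ m, k < m ∧ x ∉ W m) {X : Set D}
    (hX : ∀ x k, x ∉ W k → (x ∈ X ↔ k % 2 = 1)) :
    ∃ α ∈ Ico (1 : Ordinal.{0}) (Ordinal.omega 1),
      X ∈ C.toEffectiveTopologicalSpace.Hausdorff α := by
  have hre : REPred fun a : ℕ × ℕ × ℕ =>
      WayBelow (C.b a.2.1) (C.b a.2.2) ∧ C.b a.2.2 ∈ W a.1 :=
    (C.re_wayBelow.comp (Computable.pair (Computable.snd.comp Computable.snd)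
      (Computable.fst.comp Computable.snd))).and
    ((C.rePred_mem_of_uniformlySigma1 hW).comp (Computable.pair Computable.fst
      (Computable.snd.comp Computable.snd)))
  obtain ⟨q, hqp, hq⟩ := hre.exists_primrecRel
  have hR := primrecRel_step hqp
  have hwf := wellFounded_step hW hWX hq
  have hwo := isWellOrder_codeLT hwf
  set s := codeLT (Step q)
  -- `A n` will be the basic open set of the last entry `e` of the chain coded by `n / 2`, provided
  -- that `n` is the copy with the parity of `level e + 1`. At the other copy, at the empty list and
  -- at non-chains it is empty.
  let N : ℕ → ℕ → ℕ → Prop := fun n i e => (ofCode (n / 2)).IsChain (Step q) ∧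
    (ofCode (n / 2)).getLast? = some e ∧ index e = i ∧ n % 2 = (level e + 1) % 2
  let A : ℕ → Set D := fun n => ⋃ i ∈ {i | ∃ e, N n i e}, C.toEffectiveTopologicalSpace.O i
  have hA : ∀ {n x}, x ∈ A n ↔ ∃ e, N n (index e) e ∧ WayBelow (C.b (index e)) x := by
    intro n x
    simp only [A, mem_iUnion, mem_O, mem_ofPred_eq, exists_prop]
    constructor
    · rintro ⟨i, ⟨e, he⟩, hx⟩
      obtain rfl := he.2.2.1
      exact ⟨e, he, hx⟩
    · rintro ⟨e, he, hx⟩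
      exact ⟨_, ⟨e, he⟩, hx⟩
  have hN : PrimrecPred fun x : (ℕ × ℕ) × ℕ => N x.1.1 x.1.2 x.2 := by
    have h1 : Primrec fun x : (ℕ × ℕ) × ℕ => ofCode (x.1.1 / 2) :=
      primrec_ofCode.comp (Primrec.nat_div.comp (Primrec.fst.comp Primrec.fst) (Primrec.const 2))
    refine ((primrecPred_isChain hR).comp h1).and (PrimrecPred.and ?_ (PrimrecPred.and ?_ ?_))
    · refine (Primrec.eq.comp (Primrec.list_head?.comp (Primrec.list_reverse.comp h1))
        (Primrec.option_some.comp Primrec.snd)).of_eq fun x => ?_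
      rw [List.head?_reverse]
    · exact Primrec.eq.comp (primrec_index.comp Primrec.snd) (Primrec.snd.comp Primrec.fst)
    · exact Primrec.eq.comp
        (Primrec.nat_mod.comp (Primrec.fst.comp Primrec.fst) (Primrec.const 2))
        (Primrec.nat_mod.comp (Primrec.succ.comp (primrec_level.comp Primrec.snd))
          (Primrec.const 2))
  have hcode : ∀ l (i : ℕ), i < 2 → ∃ n, ofCode (n / 2) = l ∧ n % 2 = i := by
    intro l i hi
    refine ⟨2 * Encodable.encode l + i, ?_, by omega⟩
    rw [show (2 * Encodable.encode l + i) / 2 = Encodable.encode l by omega, ofCode,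
      Denumerable.ofNat_encode]
  -- the least stage at which a point is seen decides its membership
  have hleast : ∀ {n x}, x ∈ A n → (∀ m, x ∈ A m → ¬ doubleRank s m < doubleRank s n) →
      (x ∈ X ↔ n % 2 = 1) := by
    intro n x hx hmin
    obtain ⟨e, ⟨hch, hlast, -, hpar⟩, hex⟩ := hA.1 hx
    rw [hpar]
    refine hX x _ fun hxW => ?_
    -- If `x` were in `W (level e + 1)`, a basis element between would prolong the chain, and the
    -- longer chain would give a set containing `x` at an earlier place.
    obtain ⟨j, h1, h2, h3⟩ := C.exists_wayBelow_of_mem hW hxW hex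
    obtain ⟨w, hw⟩ := (hq (level e + 1, index e, j)).1 ⟨h1, h2⟩
    obtain ⟨m, hm, hm2⟩ := hcode (ofCode (n / 2) ++ [code (level e + 1) j w])
      ((level e + 1 + 1) % 2) (Nat.mod_lt _ two_pos)
    have hch' : (ofCode (m / 2)).IsChain (Step q) := by
      rw [hm, List.isChain_append]
      refine ⟨hch, by simp, ?_⟩
      intro a ha b hb
      rw [hlast] at ha
      obtain rfl : e = a := by simpa using ha
      obtain rfl : code (level e + 1) j w = b := by simpa using hb
      simpa [Step] using hw
    refine hmin m (hA.2 ⟨code (level e + 1) j w, ⟨hch', ?_, rfl, ?_⟩, ?_⟩) ?_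
    · simp [hm]
    · simpa using hm2
    · simpa using h3
    · refine (doubleRank_lt_iff s).2 (Or.inl (chainKey_lt_iff.2 (Or.inl ⟨hch', Or.inr ?_⟩)))
      rw [hm]
      exact key_append_singleton_lt _ _
  -- The type `2 * type s` is even, so the differences used are those at odd places.
  have hparity : ∀ n, ¬ OrdinalSameParity (doubleRank s n) (2 * Ordinal.type s) ↔ n % 2 = 1 := by
    intro n
    rw [OrdinalSameParity, doubleRank_mod_two, Ordinal.mul_mod, Nat.cast_eq_zero]
    omega
  have hdouble : PrimrecRel (doubleLE s) := by
    have h1 := Primrec.nat_div.comp (Primrec.fst (α := ℕ) (β := ℕ)) (Primrec.const 2)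
    have h2 := Primrec.nat_div.comp (Primrec.snd (α := ℕ) (β := ℕ)) (Primrec.const 2)
    exact ((primrecRel_codeLT hR).comp h1 h2).or
      ((Primrec.eq.comp h1 h2).and (Primrec.nat_le.comp Primrec.fst Primrec.snd))
  have hrefl : ∀ n, doubleLE s n n := fun n => Or.inr ⟨rfl, le_rfl⟩
  refine ⟨2 * Ordinal.type s, two_mul_type_mem_Ico s, doubleLE s, doubleRank s, _, A,
    isOrdinalIso_double s, rfl, hdouble.computablePred, ?_, ?_, ?_⟩
  · refine (PrimrecPred.computablePred ((Primrec.eq.comp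
      (Primrec.nat_mod.comp Primrec.id (Primrec.const 2)) (Primrec.const 1)))).of_eq fun n => ?_
    exact ((and_iff_right (hrefl n)).trans (hparity n)).symm
  · exact ⟨_, REPred.exists_nat (p := fun (x : ℕ × ℕ) e => N x.1 x.2 e) hN.computablePred.to_re,
      fun n => rfl⟩
  · ext x
    simp only [mem_iUnion, mem_sdiff, mem_ofPred_eq, exists_prop, hparity, hrefl, true_and]
    constructor
    · intro hx
      obtain ⟨_, ⟨i, rfl⟩, hi⟩ := (C.isDomainBasis x).1
      -- A one-element chain is subject to no condition, so every point is in some `A n`. The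
      -- remainder is 1 because the level is 0 and parity is taken of the next level.
      obtain ⟨n, hn, hn2⟩ := hcode [code 0 i 0] 1 one_lt_two
      have hxn : x ∈ A n := hA.2 ⟨code 0 i 0, ⟨by simp [hn], by simp [hn], rfl, by simpa⟩, by simpa⟩
      obtain ⟨p, hp, hmin⟩ := exists_minimalFor_of_wellFoundedLT (fun n => x ∈ A n)
        (doubleRank s) ⟨n, hxn⟩
      have hmin' : ∀ m, x ∈ A m → ¬ doubleRank s m < doubleRank s p :=
        fun m hm h => h.not_ge (hmin hm h.le)
      exact ⟨p, (hleast hp hmin').1 hx, hp, fun ⟨m, h, hm⟩ => hmin' m hm h⟩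
    · rintro ⟨p, hp1, hp, hmin⟩
      exact (hleast hp fun m hm h => hmin ⟨m, h, hm⟩).2 hp1

/-! ### Interleaving the two representations, and the theorem -/

theorem exists_mem_hausdorff_of_mem_gdelta_of_mem_fsigma {X : Set D}
    (hG : X ∈ C.toEffectiveTopologicalSpace.Gdelta)
    (hF : X ∈ C.toEffectiveTopologicalSpace.Fsigma) :
    ∃ α ∈ Ico (1 : Ordinal.{0}) (Ordinal.omega 1),
      X ∈ C.toEffectiveTopologicalSpace.Hausdorff α := by
  classical
  obtain ⟨U, hU, hXU⟩ := hG
  obtain ⟨F, hF, hXF⟩ := hF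
  have hf : Computable fun k : ℕ => (k / 2).unpair.1 :=
    (Primrec.fst.comp (Primrec.unpair.comp
      (Primrec.nat_div.comp Primrec.id (Primrec.const 2)))).to_comp
  have hS : ComputablePred fun k : ℕ => k % 2 = 0 :=
    PrimrecPred.computablePred
      (Primrec.eq.comp (Primrec.nat_mod.comp Primrec.id (Primrec.const 2)) (Primrec.const 0))
  -- each set of both sequences is repeated infinitely often
  refine exists_mem_hausdorff (EffectiveTopologicalSpace.UniformlySigma1.ite hU hF hS hf hf)
    (fun x k => ?_) fun x k hx => ?_
  · by_cases hx : x ∈ X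
    · obtain ⟨n, hn⟩ := mem_iUnion.1 (hXF ▸ hx)
      have := Nat.right_le_pair n k
      refine ⟨2 * Nat.pair n k + 1, by omega, ?_⟩
      rw [if_neg (by omega), show (2 * Nat.pair n k + 1) / 2 = Nat.pair n k by omega]
      simpa using hn
    · obtain ⟨n, hn⟩ : ∃ n, x ∉ U n := by simpa [hXU] using hx
      have := Nat.right_le_pair n (k + 1)
      -- Pairing with `k + 1` rather than `k` makes the even index exceed `k` also when `k = 0`.
      refine ⟨2 * Nat.pair n (k + 1), by omega, ?_⟩
      rw [if_pos (by omega), show 2 * Nat.pair n (k + 1) / 2 = Nat.pair n (k + 1) by omega]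
      simpa using hn
  -- Missing some `U n` excludes `x` from `X`; missing the complement of some `F n` puts `x` into
  -- `X`.
  · split_ifs at hx with hk
    · refine iff_of_false (fun h => hx ?_) (by omega)
      rw [hXU] at h
      exact mem_iInter.1 h _
    · refine iff_of_true ?_ (by omega)
      rw [hXF]
      exact mem_iUnion.2 ⟨_, not_notMem.1 hx⟩

end EffectiveOmegaContinuousDomain

theorem corollary5p10 {D : Type*} [PartialOrder D] [TopologicalSpace D]
    [Topology.IsScott D Set.univ] (C : EffectiveOmegaContinuousDomain D) :
    C.toEffectiveTopologicalSpace.Gdelta ∩ C.toEffectiveTopologicalSpace.Fsigma ⊆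
        (⋃ α ∈ Set.Ico (1 : Ordinal.{0}) (Ordinal.omega 1),
          C.toEffectiveTopologicalSpace.Hausdorff α) ∧
      (⋃ α ∈ Set.Ico (1 : Ordinal.{0}) (Ordinal.omega 1),
          C.toEffectiveTopologicalSpace.Hausdorff α) ⊆
        C.toEffectiveTopologicalSpace.Delta2 := by
  refine ⟨fun X hX => ?_, Set.iUnion₂_subset fun α _ =>
    EffectiveTopologicalSpace.hausdorff_subset_delta2 α⟩
  obtain ⟨α, hα, h⟩ :=
    EffectiveOmegaContinuousDomain.exists_mem_hausdorff_of_mem_gdelta_of_mem_fsigma hX.1 hX.2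
  exact Set.mem_biUnion hα h
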